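/- Let $R$ be a principal ideal domain, with a fixed choice of representatives (up to units) for greatest common divisors $(\;)$ and least common multiples $[\;]$; the lcm of the empty set is $1$. Let $G$ be a finite simple graph with ordered vertices $v_1,\dots,v_n$, let $m_i\in R\setminus\{0\}$ be a label of the vertex $v_i$ for each $i$, and let $r_e\in R\setminus\{0\}$ be a label of the edge $e$ for each edge $e$ of $G$. Let $$\hat R_G=\{(f_{v_1},\dots,f_{v_n})\in m_1R\times\cdots\times m_nR \;:\; f_u\equiv f_v \bmod r_{uv}R \text{ for every edge } uv\}$$ be the $R$-module of (extending generalized) splines. An $i$-th flow-up class is a spline $F$ with $f_{v_i}\neq 0$ and $f_{v_s}=0$ for all $s<i$. A trail is a walk in $G$ without repeated edges. For a trail $P_{ji}$ from $v_j$ to $v_i$ let $(P_{ji})$ be the gcd of its edge labels, and let $[\{(P_{ji})\}]$ be the lcm of these gcds over all trails from $v_j$ to $v_i$. Put $$\mathcal Q^{(i)}=\Big[\,m_i,\ \big\{(m_j,[\{(P_{ji})\}]) : j>i\big\},\ \big\{[\{(P_{si})\}] : s<i\big\}\Big],\qquad \hat Q_G=\prod_{i=1}^n \mathcal Q^{(i)}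 .$$ Then for each $i=1,\dots,n$ there exists an $i$-th flow-up class $F^{(i)}$ whose leading entry is $f^{(i)}_{v_i}=\mathcal Q^{(i)}$. Moreover, any flow-up classes $F^{(1)},\dots,F^{(n)}$ with these leading entries form an $R$-module basis of $\hat R_G$, and $$|F^{(1)},F^{(2)},\dots,F^{(n)}|=\pm\hat Q_G ,$$ where the left side is the determinant of the matrix whose columns are the splines $F^{(1)},\dots,F^{(n)}$ and whose rows, from top to bottom, correspond to $v_n,\dots,v_1$. -/

import Mathlib

noncomputable section

namespace ExtendedSpline

variable {R : Type*} [CommRing R] {n : ℕ}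

/-- Extending generalized splines on a graph `G` with ordered vertices `v_0, …, v_{n-1}`, vertex
modules `M_v = m_v R`, edge modules `M_e = R / r_e R`, and the natural quotient maps
`M_v → M_e` for every edge `e` at `v`. Only the values of `r` on edges of `G` are used. -/
def splineModule (G : SimpleGraph (Fin n)) (m : Fin n → R) (r : Sym2 (Fin n) → R) :
    Submodule R (Fin n → R) where
  carrier := {f | (∀ v, f v ∈ Ideal.span {m v}) ∧
    ∀ u v, G.Adj u v →
      Ideal.Quotient.mk (Ideal.span {r s(u, v)}) (f u) =
        Ideal.Quotient.mk (Ideal.span {r s(u, v)}) (f v)}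
  zero_mem' := ⟨fun v => Ideal.zero_mem _, fun _ _ _ => rfl⟩
  add_mem' := by
    rintro f g ⟨hf, hf'⟩ ⟨hg, hg'⟩
    refine ⟨fun v => Ideal.add_mem _ (hf v) (hg v), fun u v h => ?_⟩
    simp only [Pi.add_apply, map_add, hf' u v h, hg' u v h]
  smul_mem' := by
    rintro c f ⟨hf, hf'⟩
    refine ⟨fun v => Ideal.mul_mem_left _ c (hf v), fun u v h => ?_⟩
    simp only [Pi.smul_apply, smul_eq_mul, map_mul, hf' u v h]

/-- `f` is an `i`-th flow-up class: a spline with `f i ≠ 0` and `f s = 0` for all `s < i`. -/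
def IsFlowUp (G : SimpleGraph (Fin n)) (m : Fin n → R) (r : Sym2 (Fin n) → R) (i : Fin n)
    (f : Fin n → R) : Prop :=
  f ∈ splineModule G m r ∧ f i ≠ 0 ∧ ∀ s, s < i → f s = 0

/-- The determinant `|F_1, …, F_n|`: the splines are the columns, and the rows are the vertices
listed from the last one (top) to the first one (bottom). -/
def splineDet (F : Fin n → Fin n → R) : R :=
  (Matrix.of fun a b : Fin n => F b a.rev).det

/-- The trails (walks without repeated edge) from `j` to `i`. -/
abbrev Trail (G : SimpleGraph (Fin n)) (j i : Fin n) : Type :=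
  {p : G.Walk j i // p.IsTrail}

theorem finite_trail (G : SimpleGraph (Fin n)) (j i : Fin n) : Finite (Trail G j i) := by
  classical
  refine Finite.of_injective
    (β := {p : G.Walk j i // p.length < G.edgeFinset.card + 1})
    (fun p => ⟨p.1, Nat.lt_succ_of_le p.2.length_le_card_edgeFinset⟩) ?_
  intro p q h
  exact Subtype.ext (congrArg (fun x => x.1) h)

instance fintypeTrail (G : SimpleGraph (Fin n)) (j i : Fin n) : Fintype (Trail G j i) :=
  @Fintype.ofFinite _ (finite_trail G j i)

variable [NormalizedGCDMonoid R]

/-- `(P)`: the greatest common divisor of the edge labels of the trail `P`. -/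
def trailGcd (G : SimpleGraph (Fin n)) (r : Sym2 (Fin n) → R) {j i : Fin n}
    (P : Trail G j i) : R :=
  P.1.edges.toFinset.gcd r

/-- `[{(P_{ji})}]`: the least common multiple of the numbers `(P)` over all trails `P` from `j`
to `i`; it is `1` if there is no such trail. -/
def trailLcm (G : SimpleGraph (Fin n)) (r : Sym2 (Fin n) → R) (j i : Fin n) : R :=
  Finset.univ.lcm fun P : Trail G j i => trailGcd G r P

/-- `Q^{(i)} = [m_i, {(m_j, [{(P_{ji})}]) | j > i}, {[{(P_{si})}] | s < i}]`. -/
def keyFactor (G : SimpleGraph (Fin n)) (m : Fin n → R) (r : Sym2 (Fin n) → R)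
    (i : Fin n) : R :=
  lcm (m i)
    (lcm ((Finset.Ioi i).lcm fun j => gcd (m j) (trailLcm G r j i))
      ((Finset.Iio i).lcm fun s => trailLcm G r s i))

/-- The key element `Q̂_G = ∏ᵢ Q^{(i)}`. -/
def keyElement (G : SimpleGraph (Fin n)) (m : Fin n → R) (r : Sym2 (Fin n) → R) : R :=
  ∏ i, keyFactor G m r i

end ExtendedSpline

end

/-! Write D(u,v) for `trailLcm G r u v`. Every spline satisfies D(u,v) ∣ f u - f v for all pairs, so
Q^(i) divides the i-th entry of any spline vanishing before i (`keyFactor_dvd`). Conversely,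
concatenating trails makes D ultrametric (`gcd_trailLcm_dvd`), which is the pairwise compatibility
that the Chinese remainder theorem needs to extend values one vertex at a time (`exists_extension`).
Starting from 0 before i and Q^(i) at i gives the flow-up class. Minimal leading entries then give a
basis by triangular elimination, and a triangular determinant. -/

namespace ExtendedSpline

/-! ### Divisibility and the Chinese remainder theorem -/

section GcdLcm

variable {R : Type*} [CommRing R] [IsDomain R] [NormalizedGCDMonoid R]

theorem gcd_lcm_dvd (a b c : R) : gcd a (lcm b c) ∣ lcm (gcd a b) (gcd a c) := by
  by_cases hg : gcd a (gcd b c) = 0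
  · obtain ⟨rfl, h⟩ := (gcd_eq_zero_iff _ _).1 hg
    obtain ⟨rfl, rfl⟩ := (gcd_eq_zero_iff _ _).1 h
    simp
  refine (mul_dvd_mul_iff_right hg).1 ?_
  have hL : gcd a b * gcd a c ∣ lcm (gcd a b) (gcd a c) * gcd a (gcd b c) := by
    have h1 := (gcd_mul_lcm (gcd a b) (gcd a c)).symm.dvd
    rw [mul_comm (gcd (gcd a b) (gcd a c))] at h1
    refine h1.trans (mul_dvd_mul_left _ ?_)
    exact dvd_gcd ((gcd_dvd_left _ _).trans (gcd_dvd_left _ _))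
      (gcd_dvd_gcd (gcd_dvd_right _ _) (gcd_dvd_right _ _))
  refine dvd_trans ?_ hL
  have hbc : lcm b c * gcd b c ∣ b * c := by
    rw [mul_comm]; exact (gcd_mul_lcm b c).dvd
  -- Two uses expand the product of gcds, leaving the four products `a * a`, `a * c`, `a * b`, `b *
  -- c` to check.
  have key : ∀ x y : R, gcd a (lcm b c) * gcd a (gcd b c) ∣ a * x →
      gcd a (lcm b c) * gcd a (gcd b c) ∣ y * x →
      gcd a (lcm b c) * gcd a (gcd b c) ∣ gcd a y * x := fun x y h1 h2 =>
    (dvd_gcd h1 h2).trans (gcd_mul_right' x a y).dvd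
  have hb : gcd a (gcd b c) ∣ b := (gcd_dvd_right _ _).trans (gcd_dvd_left _ _)
  have hc : gcd a (gcd b c) ∣ c := (gcd_dvd_right _ _).trans (gcd_dvd_right _ _)
  have hla : gcd a (lcm b c) ∣ a := gcd_dvd_left _ _
  have hga : gcd a (gcd b c) ∣ a := gcd_dvd_left _ _
  refine key _ _ ?_ ?_
  · rw [mul_comm a]
    refine key _ _ (mul_dvd_mul hla hga) ?_
    rw [mul_comm c]
    exact mul_dvd_mul hla hc
  · rw [mul_comm b]
    refine key _ _ (mul_dvd_mul hla hb) ?_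
    rw [mul_comm c]
    exact (mul_dvd_mul (gcd_dvd_right _ _) (gcd_dvd_right _ _)).trans hbc

theorem gcd_finset_lcm_dvd {ι : Type*} {s : Finset ι} {f : ι → R} {a c : R}
    (h : ∀ k ∈ s, gcd a (f k) ∣ c) : gcd a (s.lcm f) ∣ c := by
  classical
  induction s using Finset.induction_on with
  | empty => simp
  | insert k s _ ih =>
    rw [Finset.lcm_insert]
    exact (gcd_lcm_dvd _ _ _).trans (lcm_dvd (h k (Finset.mem_insert_self _ _))
      (ih fun j hj => h j (Finset.mem_insert_of_mem hj)))

variable [IsPrincipalIdealRing R]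

/-- The Chinese remainder theorem for moduli that need not be coprime. -/
theorem exists_dvd_sub_of_pairwise {ι : Type*} (s : Finset ι) (d a : ι → R)
    (h : ∀ j ∈ s, ∀ k ∈ s, gcd (d j) (d k) ∣ a j - a k) :
    ∃ x, ∀ k ∈ s, d k ∣ x - a k := by
  classical
  induction s using Finset.induction_on with
  | empty => exact ⟨0, by simp⟩
  | insert k s _ ih =>
    obtain ⟨x, hx⟩ := ih fun j hj l hl =>
      h j (Finset.mem_insert_of_mem hj) l (Finset.mem_insert_of_mem hl)
    have hxk : gcd (d k) (s.lcm d) ∣ x - a k := gcd_finset_lcm_dvd fun j hj => by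
      have h1 := h j (Finset.mem_insert_of_mem hj) k (Finset.mem_insert_self _ _)
      rw [gcd_comm] at h1
      have h2 := dvd_add ((gcd_dvd_right (d k) (d j)).trans (hx j hj)) h1
      rwa [sub_add_sub_cancel] at h2
    obtain ⟨c, hc⟩ := hxk
    obtain ⟨p, q, hpq⟩ := exists_gcd_eq_mul_add_mul (d k) (s.lcm d)
    -- The Bézout correction is a multiple of every earlier modulus and leaves the error `d k * p *
    -- c` at `k`.
    refine ⟨x - s.lcm d * q * c, fun j hj => ?_⟩
    rcases Finset.mem_insert.1 hj with rfl | hj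
    · refine ⟨p * c, ?_⟩
      rw [hpq] at hc
      linear_combination hc
    · rw [sub_right_comm]
      refine dvd_sub (hx j hj) ?_
      rw [mul_assoc]
      exact (Finset.dvd_lcm hj).mul_right _

/-- Values on a set of vertices that are compatible with an ultrametric system of moduli `D` and
vertex moduli `μ` extend to all vertices. -/
theorem exists_extension {V : Type*} [Fintype V] (D : V → V → R) (μ : V → R)
    (hDsymm : ∀ u v, D u v ∣ D v u) (hD : ∀ u w v, gcd (D u w) (D w v) ∣ D u v)
    (hμ : ∀ u w, gcd (μ u) (D u w) ∣ μ w) (S : Finset V) (f : V → R)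
    (hf : ∀ u ∈ S, ∀ v ∈ S, D u v ∣ f u - f v) (hfμ : ∀ u ∈ S, μ u ∣ f u) :
    ∃ g : V → R, (∀ u ∈ S, g u = f u) ∧ (∀ u v, D u v ∣ g u - g v) ∧ ∀ u, μ u ∣ g u := by
  classical
  suffices H : ∀ T : Finset V, ∃ g : V → R, (∀ u ∈ S, g u = f u) ∧
      (∀ u ∈ S ∪ T, ∀ v ∈ S ∪ T, D u v ∣ g u - g v) ∧ ∀ u ∈ S ∪ T, μ u ∣ g u by
    obtain ⟨g, h1, h2, h3⟩ := H Finset.univ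
    exact ⟨g, h1, fun u v => h2 u (by simp) v (by simp), fun u => h3 u (by simp)⟩
  intro T
  induction T using Finset.induction_on with
  | empty => exact ⟨f, fun _ _ => rfl, by simpa using hf, by simpa using hfμ⟩
  | insert w T _ ih =>
    obtain ⟨g, h1, h2, h3⟩ := ih
    by_cases hw : w ∈ S ∪ T
    · have : S ∪ insert w T = S ∪ T := by
        rw [Finset.union_insert, Finset.insert_eq_of_mem hw]
      rw [this]
      exact ⟨g, h1, h2, h3⟩
    -- `none` carries the vertex condition `μ w ∣ x`; `some u` carries the congruence with the value
    -- at `u`.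
    obtain ⟨x, hx⟩ := exists_dvd_sub_of_pairwise (Finset.insertNone (S ∪ T))
      (fun o => o.elim (μ w) fun u => D u w) (fun o => o.elim 0 g) (by
        have hmix : ∀ u ∈ S ∪ T, gcd (μ w) (D u w) ∣ g u := fun u hu =>
          (gcd_dvd_gcd dvd_rfl (hDsymm u w)).trans ((hμ w u).trans (h3 u hu))
        rintro (_ | u) hu (_ | v) hv
        · simp
        · simpa using hmix v (Finset.some_mem_insertNone.1 hv)
        · simpa [gcd_comm] using hmix u (Finset.some_mem_insertNone.1 hu)
        · exact (gcd_dvd_gcd dvd_rfl (hDsymm v w)).trans ((hD u w v).trans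
            (h2 u (Finset.some_mem_insertNone.1 hu) v (Finset.some_mem_insertNone.1 hv))))
    have hxμ : μ w ∣ x := by simpa using hx none (Finset.none_mem_insertNone)
    have hxD : ∀ u ∈ S ∪ T, D u w ∣ x - g u := fun u hu =>
      hx (some u) (Finset.some_mem_insertNone.2 hu)
    have hne : ∀ u ∈ S ∪ T, u ≠ w := fun u hu h => hw (h ▸ hu)
    refine ⟨Function.update g w x, fun u hu => ?_, ?_, ?_⟩
    · rw [Function.update_of_ne (hne u (Finset.mem_union_left _ hu)), h1 u hu]
    · intro u hu v hv
      rw [Finset.union_insert, Finset.mem_insert] at hu hv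
      rcases hu with rfl | hu <;> rcases hv with rfl | hv
      · simp
      · rw [Function.update_self, Function.update_of_ne (hne v hv)]
        exact (hDsymm _ _).trans (hxD v hv)
      · rw [Function.update_self, Function.update_of_ne (hne u hu), dvd_sub_comm]
        exact hxD u hu
      · rw [Function.update_of_ne (hne u hu), Function.update_of_ne (hne v hv)]
        exact h2 u hu v hv
    · intro u hu
      rw [Finset.union_insert, Finset.mem_insert] at hu
      rcases hu with rfl | hu
      · rwa [Function.update_self]
      · rw [Function.update_of_ne (hne u hu)]
        exact h3 u hu

end GcdLcm

/-! ### Trail moduli and the key factors -/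

section Trails

variable {R : Type*} [CommRing R] {n : ℕ} {G : SimpleGraph (Fin n)} {m : Fin n → R}
  {r : Sym2 (Fin n) → R}

theorem mem_splineModule_iff {f : Fin n → R} :
    f ∈ splineModule G m r ↔
      (∀ v, m v ∣ f v) ∧ ∀ u v, G.Adj u v → r s(u, v) ∣ f u - f v := by
  change ((∀ v, f v ∈ Ideal.span {m v}) ∧ _) ↔ _
  simp only [Ideal.Quotient.eq, Ideal.mem_span_singleton]

theorem dvd_sub_of_walk {f : Fin n → R} (hf : f ∈ splineModule G m r) {x : R} {u v : Fin n}
    (p : G.Walk u v) (hx : ∀ e ∈ p.edges, x ∣ r e) : x ∣ f u - f v := by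
  induction p with
  | nil => simp
  | @cons u w v h p ih =>
    rw [← sub_add_sub_cancel (f u) (f w) (f v)]
    simp only [SimpleGraph.Walk.edges_cons, List.mem_cons, forall_eq_or_imp] at hx
    exact dvd_add (hx.1.trans ((mem_splineModule_iff.1 hf).2 _ _ h)) (ih hx.2)

variable [NormalizedGCDMonoid R]

theorem trailGcd_dvd {i j : Fin n} (P : Trail G j i) {e : Sym2 (Fin n)} (he : e ∈ P.1.edges) :
    trailGcd G r P ∣ r e :=
  Finset.gcd_dvd (List.mem_toFinset.2 he)

theorem trailLcm_dvd_sub {f : Fin n → R} (hf : f ∈ splineModule G m r) (j i : Fin n) :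
    trailLcm G r j i ∣ f j - f i :=
  Finset.lcm_dvd fun P _ => dvd_sub_of_walk hf P.1 fun _ he => trailGcd_dvd P he

/-- Shortcutting a walk to a path keeps only edges of the walk, so arbitrary walks may replace
trails. -/
theorem dvd_trailLcm_of_walk {x : R} {u v : Fin n} (p : G.Walk u v)
    (hx : ∀ e ∈ p.edges, x ∣ r e) : x ∣ trailLcm G r u v := by
  classical
  let P : Trail G u v := ⟨p.bypass, p.bypass_isPath.isTrail⟩
  refine dvd_trans ?_ (Finset.dvd_lcm (Finset.mem_univ P))
  exact Finset.dvd_gcd fun e he => hx e (p.edges_bypass_subset_edges (List.mem_toFinset.1 he))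

theorem trailLcm_dvd_symm (u v : Fin n) : trailLcm G r u v ∣ trailLcm G r v u :=
  Finset.lcm_dvd fun P _ => dvd_trailLcm_of_walk P.1.reverse fun e he =>
    trailGcd_dvd P (by simpa using he)

/-- The empty trail has gcd 0. -/
theorem trailLcm_self (u : Fin n) : trailLcm G r u u = 0 :=
  zero_dvd_iff.1 (dvd_trailLcm_of_walk (SimpleGraph.Walk.nil : G.Walk u u) (by simp))

theorem trailLcm_ne_zero [IsDomain R] (hr : ∀ e ∈ G.edgeSet, r e ≠ 0) {u v : Fin n}
    (huv : u ≠ v) : trailLcm G r u v ≠ 0 := by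
  rw [trailLcm, Ne, Finset.lcm_eq_zero_iff]
  rintro ⟨⟨p, hp⟩, -, h⟩
  cases p with
  | nil => exact huv rfl
  | cons hadj p =>
    refine hr _ (G.mem_edgeSet.2 hadj) (zero_dvd_iff.1 ?_)
    rw [← h]
    exact trailGcd_dvd ⟨.cons hadj p, hp⟩ (by simp)

theorem keyFactor_dvd {i : Fin n} {f : Fin n → R} (hf : f ∈ splineModule G m r)
    (h0 : ∀ s, s < i → f s = 0) : keyFactor G m r i ∣ f i := by
  have hm := (mem_splineModule_iff.1 hf).1
  refine lcm_dvd (hm i) (lcm_dvd (Finset.lcm_dvd fun j _ => ?_) (Finset.lcm_dvd fun s hs => ?_))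
  · rw [← sub_sub_cancel (f j) (f i)]
    exact dvd_sub ((gcd_dvd_left _ _).trans (hm j))
      ((gcd_dvd_right _ _).trans (trailLcm_dvd_sub hf j i))
  · simpa [h0 s (Finset.mem_Iio.1 hs)] using trailLcm_dvd_sub hf s i

variable [IsDomain R]

theorem gcd_trailLcm_dvd (u w v : Fin n) :
    gcd (trailLcm G r u w) (trailLcm G r w v) ∣ trailLcm G r u v := by
  refine gcd_finset_lcm_dvd fun Q _ => ?_
  rw [gcd_comm]
  refine gcd_finset_lcm_dvd fun P _ => ?_
  refine dvd_trailLcm_of_walk (P.1.append Q.1) fun e he => ?_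
  rw [SimpleGraph.Walk.edges_append, List.mem_append] at he
  rcases he with he | he
  · exact (gcd_dvd_right _ _).trans (trailGcd_dvd P he)
  · exact (gcd_dvd_left _ _).trans (trailGcd_dvd Q he)

theorem keyFactor_ne_zero (hm : ∀ v, m v ≠ 0) (hr : ∀ e ∈ G.edgeSet, r e ≠ 0) (i : Fin n) :
    keyFactor G m r i ≠ 0 := by
  simp only [keyFactor, Ne, lcm_eq_zero_iff, Finset.lcm_eq_zero_iff, not_or]
  refine ⟨hm i, ?_, ?_⟩
  · rintro ⟨j, -, hj⟩
    exact hm j ((gcd_eq_zero_iff _ _).1 hj).1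
  · rintro ⟨s, hs, h⟩
    exact trailLcm_ne_zero hr (Finset.mem_Iio.1 hs).ne h

variable [IsPrincipalIdealRing R]

theorem exists_spline_keyFactor (i : Fin n) :
    ∃ f ∈ splineModule G m r, (∀ s, s < i → f s = 0) ∧ f i = keyFactor G m r i := by
  classical
  -- All that the vertex labels force at `v`, transported along trails; the term `k = v` recovers `m
  -- v` because `trailLcm G r v v = 0`.
  let μ : Fin n → R := fun v => Finset.univ.lcm fun k => gcd (m k) (trailLcm G r k v)
  have hlt : ∀ s, s < i → trailLcm G r s i ∣ keyFactor G m r i := fun s hs =>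
    (Finset.dvd_lcm (Finset.mem_Iio.2 hs)).trans ((dvd_lcm_right _ _).trans (dvd_lcm_right _ _))
  have hμi : μ i ∣ keyFactor G m r i := Finset.lcm_dvd fun k _ => by
    rcases lt_trichotomy k i with hk | rfl | hk
    · exact (gcd_dvd_right _ _).trans (hlt k hk)
    · exact (gcd_dvd_left _ _).trans (dvd_lcm_left _ _)
    · exact (Finset.dvd_lcm (f := fun j => gcd (m j) (trailLcm G r j i))
        (Finset.mem_Ioi.2 hk)).trans ((dvd_lcm_left _ _).trans (dvd_lcm_right _ _))
  obtain ⟨g, hg, hgD, hgμ⟩ := exists_extension (trailLcm G r) μ trailLcm_dvd_symm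
    gcd_trailLcm_dvd (fun u w => by
      rw [gcd_comm]
      refine gcd_finset_lcm_dvd fun k _ => dvd_trans ?_ (Finset.dvd_lcm (Finset.mem_univ k))
      refine dvd_gcd ((gcd_dvd_right _ _).trans (gcd_dvd_left _ _)) ?_
      refine dvd_trans (dvd_gcd ?_ (gcd_dvd_left _ _)) (gcd_trailLcm_dvd k u w)
      exact (gcd_dvd_right _ _).trans (gcd_dvd_right _ _))
    (Finset.Iic i) (Pi.single i (keyFactor G m r i)) (by
      intro u hu v hv
      rcases (Finset.mem_Iic.1 hu).lt_or_eq with hu | rfl <;>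
        rcases (Finset.mem_Iic.1 hv).lt_or_eq with hv | rfl
      · simp [hu.ne, hv.ne]
      · simpa [hu.ne] using hlt u hu
      · simpa [hv.ne] using (trailLcm_dvd_symm _ _).trans (hlt v hv)
      · simp) (by
      intro u hu
      rcases (Finset.mem_Iic.1 hu).lt_or_eq with hu | rfl
      · simp [hu.ne]
      · simpa using hμi)
  refine ⟨g, mem_splineModule_iff.2 ⟨fun v => dvd_trans ?_ (hgμ v), fun u v h =>
    dvd_trans (dvd_trailLcm_of_walk h.toWalk (by simp)) (hgD u v)⟩, fun s hs => ?_, ?_⟩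
  · refine dvd_trans (dvd_gcd dvd_rfl ?_) (Finset.dvd_lcm (Finset.mem_univ v))
    rw [trailLcm_self]
    exact dvd_zero _
  · rw [hg s (Finset.mem_Iic.2 hs.le), Pi.single_eq_of_ne hs.ne]
  · rw [hg i (Finset.mem_Iic.2 le_rfl), Pi.single_eq_same]

end Trails

/-! ### Triangular systems: determinant and basis -/

section Triangular

variable {R : Type*} [CommRing R] {n : ℕ}

theorem det_of_flowUp {F : Fin n → Fin n → R} (h0 : ∀ i s, s < i → F i s = 0) :
    (Matrix.of F).det = ∏ i, F i i :=
  Matrix.det_of_isUpperTriangular fun i j hij => h0 i j hij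

theorem splineDet_eq_or_eq_neg {F : Fin n → Fin n → R} (h0 : ∀ i s, s < i → F i s = 0) :
    splineDet F = ∏ i, F i i ∨ splineDet F = -∏ i, F i i := by
  -- The sign comes from reversing the order of the rows.
  have h : splineDet F = (Equiv.Perm.sign (Fin.revPerm (n := n)) : ℤ) * ∏ i, F i i := by
    rw [← det_of_flowUp h0, ← Matrix.det_transpose, ← Matrix.det_permute]
    rfl
  rcases Int.units_eq_one_or (Equiv.Perm.sign (Fin.revPerm (n := n))) with hs | hs
  · left; simp [h, hs]
  · right; simp [h, hs]

theorem linearIndependent_of_flowUp [IsDomain R] {F : Fin n → Fin n → R}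
    (h0 : ∀ i s, s < i → F i s = 0) (h1 : ∀ i, F i i ≠ 0) : LinearIndependent R F := by
  refine Matrix.linearIndependent_rows_of_det_ne_zero (A := Matrix.of F) ?_
  rw [det_of_flowUp h0]
  exact Finset.prod_ne_zero_iff.2 fun i _ => h1 i

theorem mem_span_of_flowUp {M : Submodule R (Fin n → R)} {F : Fin n → Fin n → R}
    (hF : ∀ i, F i ∈ M) (h0 : ∀ i s, s < i → F i s = 0)
    (hdvd : ∀ i, ∀ g ∈ M, (∀ s, s < i → g s = 0) → F i i ∣ g i) {g : Fin n → R} (hg : g ∈ M) :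
    g ∈ Submodule.span R (Set.range F) := by
  suffices H : ∀ k ≤ n, ∀ g ∈ M, (∀ s : Fin n, (s : ℕ) < k → g s = 0) →
      g ∈ Submodule.span R (Set.range F) from H 0 n.zero_le g hg (by simp)
  -- Descending induction on the number `k` of initial zeros: a multiple of `F k` cancels the next
  -- entry.
  intro k hk
  induction hk using Nat.decreasingInduction with
  | self =>
    intro g _ h
    have : g = 0 := funext fun s => h s s.2
    simp [this]
  | of_succ k hk ih =>
    intro g hg h
    obtain ⟨c, hc⟩ := hdvd ⟨k, hk⟩ g hg fun s hs => h s hs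
    have hmem : F ⟨k, hk⟩ ∈ Submodule.span R (Set.range F) := Submodule.subset_span ⟨_, rfl⟩
    have := ih (g - c • F ⟨k, hk⟩) (M.sub_mem hg (M.smul_mem c (hF _))) fun s hs => by
      rcases Nat.lt_succ_iff_lt_or_eq.1 hs with hs | hs
      · simp [h s hs, h0 ⟨k, hk⟩ s hs]
      · obtain rfl : s = ⟨k, hk⟩ := Fin.ext hs
        simp [hc, mul_comm]
    simpa using Submodule.add_mem _ this (Submodule.smul_mem _ c hmem)

theorem exists_basis_of_flowUp [IsDomain R] {M : Submodule R (Fin n → R)} {F : Fin n → Fin n → R}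
    (hF : ∀ i, F i ∈ M) (h0 : ∀ i s, s < i → F i s = 0) (h1 : ∀ i, F i i ≠ 0)
    (hdvd : ∀ i, ∀ g ∈ M, (∀ s, s < i → g s = 0) → F i i ∣ g i) :
    ∃ b : Module.Basis (Fin n) R M, ∀ i, (b i : Fin n → R) = F i := by
  have hM : Submodule.span R (Set.range F) = M :=
    le_antisymm (Submodule.span_le.2 (Set.range_subset_iff.2 hF))
      fun g hg => mem_span_of_flowUp hF h0 hdvd hg
  refine ⟨(Module.Basis.span (linearIndependent_of_flowUp h0 h1)).map (LinearEquiv.ofEq _ _ hM),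
    fun i => ?_⟩
  simp [Module.Basis.span_apply]

end Triangular

end ExtendedSpline

theorem mainTheorem6 {R : Type*} [CommRing R] [IsDomain R] [IsPrincipalIdealRing R]
    [NormalizedGCDMonoid R] (n : ℕ) (G : SimpleGraph (Fin n))
    (m : Fin n → R) (r : Sym2 (Fin n) → R)
    (hm : ∀ v, m v ≠ 0) (hr : ∀ e ∈ G.edgeSet, r e ≠ 0) :
    (∀ i, ∃ f : Fin n → R, ExtendedSpline.IsFlowUp G m r i f ∧
      f i = ExtendedSpline.keyFactor G m r i) ∧
    ∀ F : Fin n → Fin n → R,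
      (∀ i, ExtendedSpline.IsFlowUp G m r i (F i) ∧
        F i i = ExtendedSpline.keyFactor G m r i) →
      (∃ b : Module.Basis (Fin n) R (ExtendedSpline.splineModule G m r),
        ∀ i, (b i : Fin n → R) = F i) ∧
      (ExtendedSpline.splineDet F = ExtendedSpline.keyElement G m r ∨
        ExtendedSpline.splineDet F = -ExtendedSpline.keyElement G m r) := by

  have hQ := ExtendedSpline.keyFactor_ne_zero hm hr
  refine ⟨fun i => ?_, fun F hF => ?_⟩
  · obtain ⟨f, hf, h0, hi⟩ :=
      ExtendedSpline.exists_spline_keyFactor (G := G) (m := m) (r := r) i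
    exact ⟨f, ⟨hf, hi ▸ hQ i, h0⟩, hi⟩
  · have h0 : ∀ i s, s < i → F i s = 0 := fun i => (hF i).1.2.2
    constructor
    · refine ExtendedSpline.exists_basis_of_flowUp (fun i => (hF i).1.1) h0
        (fun i => (hF i).1.2.1) fun i g hg hg0 => ?_
      rw [(hF i).2]
      exact ExtendedSpline.keyFactor_dvd hg hg0
    · have hprod : ∏ i, F i i = ExtendedSpline.keyElement G m r :=
        Finset.prod_congr rfl fun i _ => (hF i).2
      rw [← hprod]
      exact ExtendedSpline.splineDet_eq_or_eq_neg h0
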